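/- Let $m \ge 2$, let $D \subset \mathbb{R}^m$ be a bounded domain (a bounded, non-empty, connected open set), let $\mu > 0$, and let $u : D \to \mathbb{R}$ be continuous. Let $|E|$ denote the volume of $E$, $B_r(x)$ the open ball of radius $r$ centred at $x$, $S_r(x)$ its boundary sphere, and $A_x(r_1,r_2) = \{ y \in \mathbb{R}^m : r_1 < |x-y| < r_2 \}$. Write $$M^\bullet(A,u) = \frac{1}{|A|}\int_A u(y)\,dy, \qquad M^\circ(S_r(x),u) = \frac{1}{\omega_m}\int_{S_1(0)} u(x+ry)\,dS_y ,$$ where $dS$ is the surface measure and $\omega_m$ is the area of the unit sphere $S_1(0)$. For $t>0$ put $$a^\circ(t) = \Gamma\!\left(\tfrac m2\right)\frac{I_{(m-2)/2}(t)}{(t/2)^{(m-2)/2}}, \qquad a^\bullet(t) = \Gamma\!\left(\tfrac m2+1\right)\frac{I_{m/2}(t)}{(t/2)^{m/2}} ,$$ where $I_\nu(t)=\sum_{k\ge 0} \frac{(t/2)^{2k+\nu}}{k!\,\Gamma(k+\nu+1)}$ is the modified Bessel function of the first kind of order $\nu$. For $x\in D$, $0<r_1<r_2$ with $\overline{B_{r_2}(x)}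 \subset D$, and $r \in [r_1,r_2]$, consider the identity $$M^\bullet(A_x(r_1,r_2),u) = \frac{a^\bullet(\mu r_2)\,|B_{r_2}(x)| - a^\bullet(\mu r_1)\,|B_{r_1}(x)|}{a^\circ(\mu r)\,|A_x(r_1,r_2)|}\; M^\circ(S_r(x),u). \tag{$*$}$$ Suppose that for every $x \in D$ and all $r_2>r_1>0$ with $\overline{B_{r_2}(x)}\subset D$ at least one of the following holds: (i) $(*)$ holds for every $r\in(r_1,r_2)$; (ii) $(*)$ holds for $r=r_1$; (iii) $(*)$ holds for $r=r_2$. (In particular, this is so if one and the same of (i), (ii), (iii) holds for all such $x,r_1,r_2$.) Then $u$ is $\mu$-panharmonic in $D$, that is, $u\in C^2(D)$ and $\Delta u = \mu^2 u$ in $D$. -/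

import Mathlib

/-- The modified Bessel function of the first kind,
`I_ν(z) = ∑ₖ (z/2)^(2k+ν) / (k! Γ(k+ν+1))`, for real order `ν` and real argument `z > 0`
(the only arguments at which it is used). -/
noncomputable def besselI (ν z : ℝ) : ℝ :=
  ∑' k : ℕ, (z / 2) ^ (2 * (k : ℝ) + ν) / ((k.factorial : ℝ) * Real.Gamma ((k : ℝ) + ν + 1))

/-- The coefficient `a°(t) = Γ(m/2) I_{(m-2)/2}(t) / (t/2)^{(m-2)/2}`, for `t > 0`. -/
noncomputable def aCirc (m : ℕ) (t : ℝ) : ℝ :=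
  Real.Gamma ((m : ℝ) / 2) *
    (besselI (((m : ℝ) - 2) / 2) t / (t / 2) ^ (((m : ℝ) - 2) / 2))

/-- The coefficient `a•(t) = Γ(m/2 + 1) I_{m/2}(t) / (t/2)^{m/2}`, for `t > 0`. -/
noncomputable def aBullet (m : ℕ) (t : ℝ) : ℝ :=
  Real.Gamma ((m : ℝ) / 2 + 1) * (besselI ((m : ℝ) / 2) t / (t / 2) ^ ((m : ℝ) / 2))

/-- The open annulus `A_x(r₁, r₂) = {y : r₁ < |x - y| < r₂}`. -/
def annulus {m : ℕ} (x : EuclideanSpace ℝ (Fin m)) (r₁ r₂ : ℝ) :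
    Set (EuclideanSpace ℝ (Fin m)) :=
  {y | r₁ < ‖x - y‖ ∧ ‖x - y‖ < r₂}

/-- The ball `B_r(x)` is admissible with respect to `D` if its closure lies in `D`. -/
def AdmissibleBall {m : ℕ} (D : Set (EuclideanSpace ℝ (Fin m)))
    (x : EuclideanSpace ℝ (Fin m)) (r : ℝ) : Prop :=
  closure (Metric.ball x r) ⊆ D

/-- The volume mean `M•(A, u) = |A|⁻¹ ∫_A u(y) dy`. -/
noncomputable def volumeMean {m : ℕ} (A : Set (EuclideanSpace ℝ (Fin m)))
    (u : EuclideanSpace ℝ (Fin m) → ℝ) : ℝ :=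
  (MeasureTheory.volume.real A)⁻¹ * ∫ y in A, u y

/-- The spherical mean `M°(S_r(x), u) = ω_m⁻¹ ∫_{S_1(0)} u(x + r y) dS_y`, where `dS` is the
surface measure on the unit sphere and `ω_m` its total mass. -/
noncomputable def sphericalMean {m : ℕ} (x : EuclideanSpace ℝ (Fin m)) (r : ℝ)
    (u : EuclideanSpace ℝ (Fin m) → ℝ) : ℝ :=
  ((MeasureTheory.volume : MeasureTheory.Measure (EuclideanSpace ℝ (Fin m))).toSphere.real
      Set.univ)⁻¹ *
    ∫ y : Metric.sphere (0 : EuclideanSpace ℝ (Fin m)) 1,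
      u (x + r • (y : EuclideanSpace ℝ (Fin m)))
      ∂(MeasureTheory.volume : MeasureTheory.Measure (EuclideanSpace ℝ (Fin m))).toSphere

/-- The annular quadrature identity for the annulus `A_x(r₁, r₂)` and the sphere `S_r(x)`. -/
def AnnularIdentity {m : ℕ} (μ : ℝ) (u : EuclideanSpace ℝ (Fin m) → ℝ)
    (x : EuclideanSpace ℝ (Fin m)) (r₁ r₂ r : ℝ) : Prop :=
  volumeMean (annulus x r₁ r₂) u =
    (aBullet m (μ * r₂) * MeasureTheory.volume.real (Metric.ball x r₂) -
        aBullet m (μ * r₁) * MeasureTheory.volume.real (Metric.ball x r₁)) /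
      (aCirc m (μ * r) * MeasureTheory.volume.real (annulus x r₁ r₂)) *
    sphericalMean x r u

/-- `u` is `μ`-panharmonic in the open set `D`: a `C²` solution of `Δu - μ² u = 0` there. -/
def PanharmonicOn {m : ℕ} (μ : ℝ) (u : EuclideanSpace ℝ (Fin m) → ℝ)
    (D : Set (EuclideanSpace ℝ (Fin m))) : Prop :=
  ContDiffOn ℝ 2 u D ∧ ∀ x ∈ D, Laplacian.laplacian u x - μ ^ 2 * u x = 0

/-!
In polar coordinates both sides of the identity become one-dimensional integrals: it says that the
quotient `q(r) = M°(S_r(x), u) / a°(μr)` equals its own mean over `[r₁, r₂]` with weight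
`s ^ (m - 1) * a°(μs)`. If the mean always equals `q(r₁)` or `q(r₂)`, the continuous function `q` is
constant, for otherwise it would have an interval on which it lies strictly between its endpoint
values. Letting `r → 0` gives the mean value property `M°(S_r(x), u) = a°(μr) u(x)`.

By this property a radial mollification of `u` is locally a constant multiple of `u`, so `u` is
smooth. As `r → 0` its spherical means expand as `u(x) + Δu(x) r² / (2m) + o(r²)` (Pizzetti's
formula), whereas `a°(μr) = 1 + μ² r² / (2m) + o(r²)`; comparing the two gives `Δu = μ² u`.
-/

section HypergeometricLimit

open Filter Topology FormalMultilinearSeries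

/-- The coefficients `Γ(c) / (k! Γ(k + c)) = 1 / (k! (c)ₖ)` of the confluent hypergeometric limit
function, in the form in which they occur in the series of the Bessel functions. -/
noncomputable def hypLimitCoeff (c : ℝ) (k : ℕ) : ℝ :=
  Real.Gamma c / (k.factorial * Real.Gamma (k + c))

/-- The confluent hypergeometric limit function `₀F₁(; c; z)`. For `c = ν + 1` and `z = t² / 4` it
is the entire factor `Γ(ν + 1) (t/2)^(-ν) I_ν(t)` of the modified Bessel function. -/
noncomputable def hypLimit (c z : ℝ) : ℝ := ofScalarsSum (hypLimitCoeff c) z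

variable {c : ℝ}

theorem hypLimitCoeff_pos (hc : 0 < c) (k : ℕ) : 0 < hypLimitCoeff c k := by
  have := Real.Gamma_pos_of_pos hc
  have := Real.Gamma_pos_of_pos (by positivity : 0 < (k : ℝ) + c)
  unfold hypLimitCoeff
  positivity

theorem hypLimitCoeff_zero (hc : 0 < c) : hypLimitCoeff c 0 = 1 := by
  simp [hypLimitCoeff, (Real.Gamma_pos_of_pos hc).ne']

theorem hypLimitCoeff_succ (hc : 0 < c) (k : ℕ) :
    hypLimitCoeff c (k + 1) = hypLimitCoeff c k / ((k + 1) * (k + c)) := by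
  have hk : 0 < (k : ℝ) + c := by positivity
  have hΓ := (Real.Gamma_pos_of_pos hk).ne'
  rw [hypLimitCoeff, hypLimitCoeff, Nat.factorial_succ, Nat.cast_mul, Nat.cast_succ,
    add_right_comm, Real.Gamma_add_one hk.ne']
  field_simp

theorem hypLimitCoeff_add_one (hc : 0 < c) (k : ℕ) :
    hypLimitCoeff (c + 1) k * (k + c) = c * hypLimitCoeff c k := by
  have hk : 0 < (k : ℝ) + c := by positivity
  have hΓ := (Real.Gamma_pos_of_pos hk).ne'
  rw [hypLimitCoeff, hypLimitCoeff, Real.Gamma_add_one hc.ne', ← add_assoc,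
    Real.Gamma_add_one hk.ne']
  field_simp

theorem hasFPowerSeriesOnBall_hypLimit (hc : 0 < c) :
    HasFPowerSeriesOnBall (hypLimit c) (ofScalars ℝ (hypLimitCoeff c)) 0 ⊤ := by
  have hratio : Tendsto (fun k : ℕ => ‖hypLimitCoeff c k.succ‖ / ‖hypLimitCoeff c k‖)
      atTop (𝓝 0) := by
    have heq (k : ℕ) :
        ‖hypLimitCoeff c k.succ‖ / ‖hypLimitCoeff c k‖ = ((k + 1 : ℝ) * (k + c))⁻¹ := by
      have hpos := hypLimitCoeff_pos hc k
      rw [Real.norm_of_nonneg (hypLimitCoeff_pos hc _).le, Real.norm_of_nonneg hpos.le,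
        Nat.succ_eq_add_one, hypLimitCoeff_succ hc]
      field_simp
    simp only [heq]
    exact ((tendsto_atTop_add_const_right _ _ tendsto_natCast_atTop_atTop).atTop_mul_atTop₀
      (tendsto_atTop_add_const_right _ _ tendsto_natCast_atTop_atTop)).inv_tendsto_atTop
  have hradius := ofScalars_radius_eq_top_of_tendsto ℝ (hypLimitCoeff c)
    (.of_forall fun k => (hypLimitCoeff_pos hc k).ne') hratio
  have h := (ofScalars ℝ (hypLimitCoeff c)).hasFPowerSeriesOnBall (by simp [hradius])
  rwa [hradius] at h

theorem hasSum_hypLimit (hc : 0 < c) (z : ℝ) :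
    HasSum (fun k => hypLimitCoeff c k * z ^ k) (hypLimit c z) := by
  simpa [mul_comm] using (hasFPowerSeriesOnBall_hypLimit hc).hasSum (y := z) (by simp)

theorem continuous_hypLimit (hc : 0 < c) : Continuous (hypLimit c) := by
  simpa using (hasFPowerSeriesOnBall_hypLimit hc).continuousOn

theorem hypLimit_zero (hc : 0 < c) : hypLimit c 0 = 1 := by
  simp [hypLimit, hypLimitCoeff_zero hc]

theorem hasDerivAt_hypLimit_zero (hc : 0 < c) : HasDerivAt (hypLimit c) (1 / c) 0 := by
  have h := (hasFPowerSeriesOnBall_hypLimit hc).hasFPowerSeriesAt.hasDerivAt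
  have hcoeff : hypLimitCoeff c 1 = 1 / c := by
    simpa [hypLimitCoeff_zero hc] using hypLimitCoeff_succ hc 0
  simpa [ofScalars_apply_eq, hcoeff] using h

theorem hypLimit_pos (hc : 0 < c) {z : ℝ} (hz : 0 ≤ z) : 0 < hypLimit c z := by
  have h := (hasSum_hypLimit hc z).summable.le_tsum 0
    fun k _ => mul_nonneg (hypLimitCoeff_pos hc k).le (pow_nonneg hz k)
  rw [(hasSum_hypLimit hc z).tsum_eq, hypLimitCoeff_zero hc, pow_zero, mul_one] at h
  exact zero_lt_one.trans_le h

theorem hypLimit_eq_besselI (hc : 0 < c) {t : ℝ} (ht : 0 < t) :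
    hypLimit c (t ^ 2 / 4) = Real.Gamma c * (besselI (c - 1) t / (t / 2) ^ (c - 1)) := by
  have ht2 : 0 < t / 2 := by positivity
  rw [← (hasSum_hypLimit hc _).tsum_eq, besselI, ← tsum_div_const, ← tsum_mul_left]
  refine tsum_congr fun k => ?_
  have hpow : (t / 2) ^ (2 * (k : ℝ)) = (t ^ 2 / 4) ^ k := by
    rw [Real.rpow_mul ht2.le, Real.rpow_two, Real.rpow_natCast]
    ring
  have hne : (t / 2) ^ (c - 1) ≠ 0 := (Real.rpow_pos_of_pos ht2 _).ne'
  rw [Real.rpow_add ht2, hpow, hypLimitCoeff, add_assoc, sub_add_cancel]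
  field_simp

theorem integral_pow_mul_hypLimit_term {m : ℕ} (hm : 0 < m) (α r : ℝ) (k : ℕ) :
    ∫ s in (0 : ℝ)..r, s ^ (m - 1) * (hypLimitCoeff (m / 2) k * (α * s ^ 2) ^ k) =
      r ^ m / m * (hypLimitCoeff (m / 2 + 1) k * (α * r ^ 2) ^ k) := by
  have hm₀ : (0 : ℝ) < m := Nat.cast_pos.2 hm
  have hterm (s : ℝ) : s ^ (m - 1) * (hypLimitCoeff (m / 2) k * (α * s ^ 2) ^ k) =
      hypLimitCoeff (m / 2) k * α ^ k * s ^ (m - 1 + 2 * k) := by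
    rw [mul_pow, ← pow_mul, pow_add]
    ring
  have hexp : m - 1 + 2 * k + 1 = m + 2 * k := by lia
  have hcast : ((m - 1 + 2 * k : ℕ) : ℝ) + 1 = m + 2 * k := by exact_mod_cast hexp
  have hcoeff := hypLimitCoeff_add_one (half_pos hm₀) k
  simp only [hterm]
  rw [intervalIntegral.integral_const_mul, integral_pow, hexp, hcast, zero_pow (by lia),
    sub_zero, mul_pow, ← pow_mul, pow_add]
  field_simp at hcoeff ⊢
  linear_combination (-α ^ k * r ^ (2 * k) * r ^ m) * hcoeff

theorem integral_pow_mul_hypLimit {m : ℕ} (hm : 0 < m) (α r : ℝ) :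
    ∫ s in (0 : ℝ)..r, s ^ (m - 1) * hypLimit (m / 2) (α * s ^ 2) =
      r ^ m / m * hypLimit (m / 2 + 1) (α * r ^ 2) := by
  have hc : (0 : ℝ) < m / 2 := half_pos (Nat.cast_pos.2 hm)
  have hbound (k : ℕ) (s : ℝ) (hs : s ∈ Set.uIoc 0 r) :
      ‖s ^ (m - 1) * (hypLimitCoeff (m / 2) k * (α * s ^ 2) ^ k)‖ ≤
        |r| ^ (m - 1) * (hypLimitCoeff (m / 2) k * (|α| * |r| ^ 2) ^ k) := by
    have hsr : |s| ≤ |r| := by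
      simpa using Set.abs_sub_left_of_mem_uIcc (Set.uIoc_subset_uIcc hs)
    have hcoeff := hypLimitCoeff_pos hc k
    simp only [norm_mul, norm_pow, Real.norm_eq_abs, abs_of_pos hcoeff]
    gcongr
  have hsum := intervalIntegral.hasSum_integral_of_dominated_convergence
    (μ := MeasureTheory.volume)
    (F := fun k s => s ^ (m - 1) * (hypLimitCoeff (m / 2) k * (α * s ^ 2) ^ k)) _
    (fun k => Continuous.aestronglyMeasurable (by fun_prop))
    (fun k => .of_forall (hbound k))
    (.of_forall fun s _ => (hasSum_hypLimit hc _).summable.mul_left _)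
    intervalIntegrable_const
    (.of_forall fun s _ => (hasSum_hypLimit hc (α * s ^ 2)).mul_left (s ^ (m - 1)))
  simp only [integral_pow_mul_hypLimit_term hm] at hsum
  exact hsum.unique ((hasSum_hypLimit (add_pos hc one_pos) (α * r ^ 2)).mul_left (r ^ m / m))

end HypergeometricLimit

section WeightedMeans

open Set MeasureTheory

variable {q w : ℝ → ℝ} {a b : ℝ}

theorem const_mul_integral_lt_integral_mul (hab : a < b) (hq : ContinuousOn q (Icc a b))
    (hw : ContinuousOn w (Icc a b)) (hw₀ : ∀ s ∈ Ioo a b, 0 < w s) {c : ℝ}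
    (hc : ∀ s ∈ Ioo a b, c < q s) :
    c * ∫ s in a..b, w s < ∫ s in a..b, w s * q s := by
  have hwi : IntervalIntegrable w volume a b := hw.intervalIntegrable_of_Icc hab.le
  have hwq : IntervalIntegrable (fun s => w s * q s) volume a b :=
    (hw.mul hq).intervalIntegrable_of_Icc hab.le
  have hpos : 0 < ∫ s in a..b, (w s * q s - c * w s) := by
    refine intervalIntegral.intervalIntegral_pos_of_pos_on (hwq.sub (hwi.const_mul c))
      (fun s hs => ?_) hab
    nlinarith [hw₀ s hs, hc s hs]
  rw [intervalIntegral.integral_sub hwq (hwi.const_mul c),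
    intervalIntegral.integral_const_mul] at hpos
  linarith

/- `r₁` is the last point at which `q ≤ q a`, and `r₂` the first point after it at which
`q b ≤ q`. -/
theorem exists_Ioo_strictly_between_endpoint_values (hab : a ≤ b) (hq : ContinuousOn q (Icc a b))
    (hlt : q a < q b) :
    ∃ r₁ r₂, a ≤ r₁ ∧ r₁ < r₂ ∧ r₂ ≤ b ∧ ∀ s ∈ Ioo r₁ r₂, q r₁ < q s ∧ q s < q r₂ := by
  have hlow : IsCompact (Icc a b ∩ q ⁻¹' Iic (q a)) :=
    isCompact_Icc.of_isClosed_subset (hq.preimage_isClosed_of_isClosed isClosed_Icc isClosed_Iic)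
      inter_subset_left
  obtain ⟨r₁, ⟨⟨har₁, hr₁b⟩, hqr₁⟩, hlast⟩ :=
    hlow.exists_isGreatest ⟨a, left_mem_Icc.2 hab, le_refl (q a)⟩
  have hhigh : IsCompact (Icc r₁ b ∩ q ⁻¹' Ici (q b)) :=
    isCompact_Icc.of_isClosed_subset ((hq.mono (Icc_subset_Icc_left har₁)
      ).preimage_isClosed_of_isClosed isClosed_Icc isClosed_Ici) inter_subset_left
  obtain ⟨r₂, ⟨⟨hr₁₂, hr₂b⟩, hqr₂⟩, hfirst⟩ :=
    hhigh.exists_isLeast ⟨b, right_mem_Icc.2 hr₁b, le_refl (q b)⟩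
  rw [mem_preimage, mem_Iic] at hqr₁
  rw [mem_preimage, mem_Ici] at hqr₂
  have hne : r₁ ≠ r₂ := by
    rintro rfl
    linarith
  refine ⟨r₁, r₂, har₁, hr₁₂.lt_of_ne hne, hr₂b, fun s hs => ⟨?_, ?_⟩⟩
  · by_contra! hle
    exact hs.1.not_ge (hlast ⟨⟨har₁.trans hs.1.le, hs.2.le.trans hr₂b⟩, hle.trans hqr₁⟩)
  · by_contra! hle
    exact hs.2.not_ge (hfirst ⟨⟨hs.1.le, hs.2.le.trans hr₂b⟩, hqr₂.trans hle⟩)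

theorem not_lt_of_forall_weighted_mean_eq (hab : a < b) (hq : ContinuousOn q (Icc a b))
    (hw : ContinuousOn w (Icc a b)) (hw₀ : ∀ s ∈ Ioo a b, 0 < w s)
    (h : ∀ r₁ r₂, a < r₁ → r₁ < r₂ → r₂ ≤ b →
      (∫ s in r₁..r₂, w s * q s = q r₁ * ∫ s in r₁..r₂, w s) ∨
      ∫ s in r₁..r₂, w s * q s = q r₂ * ∫ s in r₁..r₂, w s) :
    ¬ q a < q b := by
  intro hlt
  obtain ⟨d, ⟨had, hdb⟩, hqd⟩ :=
    intermediate_value_Ioo hab.le hq (show (q a + q b) / 2 ∈ Ioo (q a) (q b) by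
      constructor <;> linarith)
  obtain ⟨r₁, r₂, hdr₁, hr₁₂, hr₂b, hbetween⟩ :=
    exists_Ioo_strictly_between_endpoint_values hdb.le (hq.mono (Icc_subset_Icc_left had.le))
      (by linarith)
  have har₁ := had.trans_le hdr₁
  have hsub : Icc r₁ r₂ ⊆ Icc a b := Icc_subset_Icc har₁.le hr₂b
  have hpos : ∀ s ∈ Ioo r₁ r₂, 0 < w s := fun s hs => hw₀ s (Ioo_subset_Ioo har₁.le hr₂b hs)
  have hlower := const_mul_integral_lt_integral_mul hr₁₂ (hq.mono hsub) (hw.mono hsub) hpos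
    fun s hs => (hbetween s hs).1
  have hupper := const_mul_integral_lt_integral_mul hr₁₂ (hq.mono hsub).neg (hw.mono hsub) hpos
    fun s hs => neg_lt_neg (hbetween s hs).2
  simp only [Pi.neg_apply, mul_neg, intervalIntegral.integral_neg] at hupper
  rcases h r₁ r₂ har₁ hr₁₂ hr₂b with heq | heq <;> linarith

theorem eq_of_forall_weighted_mean_eq (hab : a < b) (hq : ContinuousOn q (Icc a b))
    (hw : ContinuousOn w (Icc a b)) (hw₀ : ∀ s ∈ Ioo a b, 0 < w s)
    (h : ∀ r₁ r₂, a < r₁ → r₁ < r₂ → r₂ ≤ b →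
      (∫ s in r₁..r₂, w s * q s = q r₁ * ∫ s in r₁..r₂, w s) ∨
      ∫ s in r₁..r₂, w s * q s = q r₂ * ∫ s in r₁..r₂, w s) :
    q a = q b := by
  refine le_antisymm (not_lt.1 fun hlt => ?_)
    (not_lt.1 (not_lt_of_forall_weighted_mean_eq hab hq hw hw₀ h))
  refine not_lt_of_forall_weighted_mean_eq hab hq.neg hw hw₀ (fun r₁ r₂ har₁ hr₁₂ hr₂b => ?_)
    (neg_lt_neg hlt)
  simpa only [Pi.neg_apply, mul_neg, intervalIntegral.integral_neg, neg_mul, neg_inj] using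
    h r₁ r₂ har₁ hr₁₂ hr₂b

end WeightedMeans

section PolarCoordinates

open MeasureTheory Set Metric Module

variable {E : Type*} [NormedAddCommGroup E] [NormedSpace ℝ E] [FiniteDimensional ℝ E]
  [Nontrivial E] [MeasurableSpace E] [BorelSpace E] {F : Type*} [NormedAddCommGroup F]
  [NormedSpace ℝ F]

theorem integral_eq_integral_Ioi_integral_sphere (ν : Measure E) [ν.IsAddHaarMeasure] {f : E → F}
    (hf : Integrable f ν) :
    ∫ x, f x ∂ν = ∫ s in Ioi (0 : ℝ),
      s ^ (finrank ℝ E - 1) • ∫ y : sphere (0 : E) 1, f (s • (y : E)) ∂ν.toSphere := by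
  have hpolar := ν.measurePreserving_homeomorphUnitSphereProd
  let g : sphere (0 : E) 1 × Ioi (0 : ℝ) → F := fun p => f ((p.2 : ℝ) • (p.1 : E))
  have hg (x : ({0}ᶜ : Set E)) : g (homeomorphUnitSphereProd E x) = f x := by
    simp [g, smul_smul, norm_ne_zero_iff.2 x.2]
  have hint : Integrable g (ν.toSphere.prod (.volumeIoiPow (finrank ℝ E - 1))) := by
    rw [← hpolar.integrable_comp_emb (Homeomorph.measurableEmbedding _)]
    simp only [Function.comp_def, hg]
    exact (integrableOn_iff_comap_subtypeVal (measurableSet_singleton _).compl).1 hf.integrableOn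
  calc ∫ x, f x ∂ν = ∫ x : ({0}ᶜ : Set E), f x ∂(ν.comap (↑)) := by
        rw [integral_subtype_comap (measurableSet_singleton _).compl f, restrict_compl_singleton]
    _ = ∫ p, g p ∂ν.toSphere.prod (.volumeIoiPow (finrank ℝ E - 1)) := by
        rw [← hpolar.integral_comp (Homeomorph.measurableEmbedding _)]
        simp only [hg]
    _ = ∫ s : Ioi (0 : ℝ), ∫ y : sphere (0 : E) 1, f ((s : ℝ) • (y : E)) ∂ν.toSphere
          ∂.volumeIoiPow (finrank ℝ E - 1) := integral_prod_symm g hint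
    _ = _ := by
        simp only [Measure.volumeIoiPow, ENNReal.ofReal]
        rw [integral_withDensity_eq_integral_smul,
          integral_subtype_comap measurableSet_Ioi fun s => Real.toNNReal (s ^ (finrank ℝ E - 1)) •
            ∫ y : sphere (0 : E) 1, f (s • (y : E)) ∂ν.toSphere,
          setIntegral_congr_fun measurableSet_Ioi fun s hs => ?_]
        · rw [NNReal.smul_def, Real.coe_toNNReal _ (pow_nonneg hs.out.le _)]
        · exact (measurable_subtype_coe.pow_const _).real_toNNReal

end PolarCoordinates

section SphericalMeans

open MeasureTheory Set Metric

variable {m : ℕ} {x : EuclideanSpace ℝ (Fin m)} {u v : EuclideanSpace ℝ (Fin m) → ℝ} {s : ℝ}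

/-- The area `ω_m` of the unit sphere in `ℝᵐ`. -/
noncomputable def sphereArea (m : ℕ) : ℝ :=
  (volume : Measure (EuclideanSpace ℝ (Fin m))).toSphere.real univ

theorem sphereArea_eq (m : ℕ) :
    sphereArea m = m * volume.real (ball (0 : EuclideanSpace ℝ (Fin m)) 1) := by
  simp [sphereArea]

theorem sphereArea_pos (m : ℕ) [NeZero m] : 0 < sphereArea m := by
  rw [sphereArea_eq]
  exact mul_pos (Nat.cast_pos.2 (NeZero.pos m))
    (ENNReal.toReal_pos (measure_ball_pos _ _ one_pos).ne' measure_ball_lt_top.ne)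

theorem volume_ball_eq [NeZero m] (x : EuclideanSpace ℝ (Fin m)) {r : ℝ} (hr : 0 ≤ r) :
    volume.real (ball x r) = r ^ m / m * sphereArea m := by
  have hm : (m : ℝ) ≠ 0 := NeZero.ne _
  rw [sphereArea_eq, measureReal_def, Measure.addHaar_ball _ _ hr, ENNReal.toReal_mul,
    ENNReal.toReal_ofReal (by positivity), finrank_euclideanSpace, Fintype.card_fin,
    ← measureReal_def]
  field_simp

theorem add_smul_mem_sphere (hs : 0 ≤ s) (y : sphere (0 : EuclideanSpace ℝ (Fin m)) 1) :
    x + s • (y : EuclideanSpace ℝ (Fin m)) ∈ sphere x s := by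
  simp [norm_smul, abs_of_nonneg hs]

theorem sphericalMean_congr (hs : 0 ≤ s) (h : EqOn u v (sphere x s)) :
    sphericalMean x s u = sphericalMean x s v := by
  simp only [sphericalMean, fun y => h (add_smul_mem_sphere hs y)]

theorem sphericalMean_const [NeZero m] (x : EuclideanSpace ℝ (Fin m)) (s c : ℝ) :
    sphericalMean x s (fun _ => c) = c := by
  rw [sphericalMean, integral_const, smul_eq_mul]
  exact inv_mul_cancel_left₀ (sphereArea_pos m).ne' c

theorem sphericalMean_zero [NeZero m] (x : EuclideanSpace ℝ (Fin m))
    (u : EuclideanSpace ℝ (Fin m) → ℝ) : sphericalMean x 0 u = u x := by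
  rw [sphericalMean_congr le_rfl (v := fun _ => u x) (by simp [EqOn]), sphericalMean_const]

theorem sphericalMean_const_mul (x : EuclideanSpace ℝ (Fin m)) (s c : ℝ)
    (u : EuclideanSpace ℝ (Fin m) → ℝ) :
    sphericalMean x s (fun y => c * u y) = c * sphericalMean x s u := by
  rw [sphericalMean, sphericalMean, integral_const_mul, mul_left_comm]

theorem sphericalMean_radial_mul (hs : 0 ≤ s) (k : ℝ → ℝ) :
    sphericalMean x s (fun y => k ‖x - y‖ * u y) = k s * sphericalMean x s u := by
  rw [← sphericalMean_const_mul]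
  refine sphericalMean_congr hs fun y hy => ?_
  simp only [← dist_eq_norm, mem_sphere'.1 hy]

theorem continuousOn_sphericalMean {R : ℝ} (hu : ContinuousOn u (closedBall x R)) :
    ContinuousOn (fun s => sphericalMean x s u) (Icc 0 R) := by
  have hmem (s : ℝ) (hs : s ∈ Icc 0 R) (y : sphere (0 : EuclideanSpace ℝ (Fin m)) 1) :
      x + s • (y : EuclideanSpace ℝ (Fin m)) ∈ closedBall x R :=
    sphere_subset_closedBall.trans (closedBall_subset_closedBall hs.2) (add_smul_mem_sphere hs.1 y)
  obtain ⟨C, hC⟩ := (isCompact_closedBall x R).exists_bound_of_continuousOn hu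
  refine continuousOn_const.mul (continuousOn_of_dominated (bound := fun _ => C) (fun s hs => ?_)
    (fun s hs => .of_forall fun y => hC _ (hmem s hs y)) (integrable_const C)
    (.of_forall fun y => hu.comp (by fun_prop) fun s hs => hmem s hs y))
  exact (hu.comp_continuous (by fun_prop) (hmem s hs)).aestronglyMeasurable

theorem integral_eq_integral_sphericalMean [NeZero m] (x : EuclideanSpace ℝ (Fin m))
    (hu : Integrable u) :
    ∫ y, u y = sphereArea m * ∫ s in Ioi (0 : ℝ), s ^ (m - 1) * sphericalMean x s u := by
  rw [← integral_add_left_eq_self u x,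
    integral_eq_integral_Ioi_integral_sphere volume (hu.comp_add_left x), ← integral_const_mul]
  have hmean (s : ℝ) : ∫ y : sphere (0 : EuclideanSpace ℝ (Fin m)) 1,
      u (x + s • (y : EuclideanSpace ℝ (Fin m))) ∂volume.toSphere =
        sphereArea m * sphericalMean x s u :=
    (mul_inv_cancel_left₀ (sphereArea_pos m).ne' _).symm
  simp only [hmean, finrank_euclideanSpace, Fintype.card_fin, smul_eq_mul, mul_left_comm]

end SphericalMeans

section PanharmonicMeanProperty

open MeasureTheory Set Metric

variable {m : ℕ} {x : EuclideanSpace ℝ (Fin m)} {u : EuclideanSpace ℝ (Fin m) → ℝ}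
  {μ r₁ r₂ r R : ℝ}

/-- The radial profile `s ↦ a°(μ s)`, extended continuously to `s = 0`, where the quotient defining
`a°` takes a junk value. -/
noncomputable def panProfile (m : ℕ) (μ s : ℝ) : ℝ := hypLimit (m / 2) (μ ^ 2 / 4 * s ^ 2)

/-- The mean value property of `μ`-panharmonic functions, over the spheres of radius at most `R`
centred at `x`. -/
def PanharmonicMeanProperty (μ : ℝ) (u : EuclideanSpace ℝ (Fin m) → ℝ)
    (x : EuclideanSpace ℝ (Fin m)) (R : ℝ) : Prop :=
  ∀ s ∈ Icc 0 R, sphericalMean x s u = panProfile m μ s * u x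

theorem half_natCast_pos (m : ℕ) [NeZero m] : (0 : ℝ) < m / 2 :=
  half_pos (Nat.cast_pos.2 (NeZero.pos m))

theorem continuous_panProfile (m : ℕ) [NeZero m] (μ : ℝ) : Continuous (panProfile m μ) :=
  (continuous_hypLimit (half_natCast_pos m)).comp (by fun_prop)

theorem panProfile_pos (m : ℕ) [NeZero m] (μ s : ℝ) : 0 < panProfile m μ s :=
  hypLimit_pos (half_natCast_pos m) (by positivity)

theorem panProfile_zero (m : ℕ) [NeZero m] (μ : ℝ) : panProfile m μ 0 = 1 := by
  simp [panProfile, hypLimit_zero (half_natCast_pos m)]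

theorem aCirc_mul_eq_panProfile [NeZero m] (h : 0 < μ * r) :
    aCirc m (μ * r) = panProfile m μ r := by
  rw [panProfile, show μ ^ 2 / 4 * r ^ 2 = (μ * r) ^ 2 / 4 by ring,
    hypLimit_eq_besselI (half_natCast_pos m) h, aCirc, sub_div, div_self two_ne_zero]

theorem aBullet_mul_volume_ball [NeZero m] (hμ : 0 < μ) (hr : 0 < r)
    (x : EuclideanSpace ℝ (Fin m)) :
    aBullet m (μ * r) * volume.real (ball x r) =
      sphereArea m * ∫ s in (0 : ℝ)..r, s ^ (m - 1) * panProfile m μ s := by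
  have haBullet : aBullet m (μ * r) = hypLimit (m / 2 + 1) (μ ^ 2 / 4 * r ^ 2) := by
    rw [show μ ^ 2 / 4 * r ^ 2 = (μ * r) ^ 2 / 4 by ring,
      hypLimit_eq_besselI (add_pos (half_natCast_pos m) one_pos) (mul_pos hμ hr), aBullet,
      add_sub_cancel_right]
  simp only [panProfile]
  rw [integral_pow_mul_hypLimit (NeZero.pos m), haBullet, volume_ball_eq x hr.le]
  ring

theorem isOpen_annulus (x : EuclideanSpace ℝ (Fin m)) (r₁ r₂ : ℝ) : IsOpen (annulus x r₁ r₂) :=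
  isOpen_Ioo.preimage (by fun_prop : Continuous fun y => ‖x - y‖)

theorem annulus_subset_closedBall (x : EuclideanSpace ℝ (Fin m)) (r₁ r₂ : ℝ) :
    annulus x r₁ r₂ ⊆ closedBall x r₂ :=
  fun _ hy => mem_closedBall_iff_norm'.2 hy.2.le

theorem volume_annulus_pos [NeZero m] (x : EuclideanSpace ℝ (Fin m)) (hr₁ : 0 ≤ r₁)
    (hr : r₁ < r₂) : 0 < volume.real (annulus x r₁ r₂) := by
  obtain ⟨v, hv⟩ := exists_norm_eq (EuclideanSpace ℝ (Fin m)) (c := (r₁ + r₂) / 2) (by linarith)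
  have hne : (annulus x r₁ r₂).Nonempty := by
    refine ⟨x - v, ?_, ?_⟩ <;> rw [sub_sub_cancel, hv] <;> linarith
  exact ENNReal.toReal_pos ((isOpen_annulus x r₁ r₂).measure_pos _ hne).ne'
    ((measure_mono (annulus_subset_closedBall x r₁ r₂)).trans_lt measure_closedBall_lt_top).ne

theorem integral_annulus [NeZero m] (hr₁ : 0 ≤ r₁) (hr : r₁ ≤ r₂)
    (hu : IntegrableOn u (annulus x r₁ r₂)) :
    ∫ y in annulus x r₁ r₂, u y =
      sphereArea m * ∫ s in r₁..r₂, s ^ (m - 1) * sphericalMean x s u := by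
  have hmeas := (isOpen_annulus x r₁ r₂).measurableSet
  have hradial : (annulus x r₁ r₂).indicator u =
      fun y => (Ioo r₁ r₂).indicator 1 ‖x - y‖ * u y := by
    ext y
    by_cases hy : r₁ < ‖x - y‖ ∧ ‖x - y‖ < r₂ <;> simp [annulus, hy]
  have hmean : ∀ s ∈ Ioi (0 : ℝ), s ^ (m - 1) * sphericalMean x s ((annulus x r₁ r₂).indicator u) =
      (Ioo r₁ r₂).indicator (fun s => s ^ (m - 1) * sphericalMean x s u) s := fun s hs => by
    rw [hradial, sphericalMean_radial_mul (mem_Ioi.1 hs).le]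
    simp [indicator]
  rw [← integral_indicator hmeas,
    integral_eq_integral_sphericalMean x (hu.integrable_indicator hmeas),
    setIntegral_congr_fun measurableSet_Ioi hmean, setIntegral_indicator measurableSet_Ioo,
    inter_eq_right.2 fun s hs => mem_Ioi.2 (hr₁.trans_lt hs.1),
    intervalIntegral.integral_of_le hr, integral_Ioc_eq_integral_Ioo]

theorem AnnularIdentity.integral_eq [NeZero m] (h : AnnularIdentity μ u x r₁ r₂ r) (hμ : 0 < μ)
    (hr₁ : 0 < r₁) (h₁₂ : r₁ < r₂) (hr : 0 < r) (hu : IntegrableOn u (annulus x r₁ r₂)) :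
    ∫ s in r₁..r₂, s ^ (m - 1) * sphericalMean x s u =
      sphericalMean x r u / panProfile m μ r * ∫ s in r₁..r₂, s ^ (m - 1) * panProfile m μ s := by
  have hcont : Continuous fun s => s ^ (m - 1) * panProfile m μ s :=
    (continuous_pow _).mul (continuous_panProfile m μ)
  rw [AnnularIdentity, volumeMean, aBullet_mul_volume_ball hμ (hr₁.trans h₁₂),
    aBullet_mul_volume_ball hμ hr₁, aCirc_mul_eq_panProfile (mul_pos hμ hr),
    integral_annulus hr₁.le h₁₂.le hu, ← mul_sub,
    intervalIntegral.integral_interval_sub_left (hcont.intervalIntegrable _ _)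
      (hcont.intervalIntegrable _ _)] at h
  have hvolume := (volume_annulus_pos x hr₁.le h₁₂).ne'
  have harea := (sphereArea_pos m).ne'
  have hprofile := (panProfile_pos m μ r).ne'
  field_simp at h ⊢
  linear_combination h

theorem continuousOn_sphericalMean_div_panProfile [NeZero m] (μ : ℝ)
    (hu : ContinuousOn u (closedBall x R)) :
    ContinuousOn (fun s => sphericalMean x s u / panProfile m μ s) (Icc 0 R) :=
  (continuousOn_sphericalMean hu).div (continuous_panProfile m μ).continuousOn
    fun s _ => (panProfile_pos m μ s).ne'

/- If the identity holds at all interior radii, then by continuity its integrated form also holds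
at the endpoint `r₁`. -/
theorem integral_eq_endpoint_of_annularIdentity [NeZero m] (hμ : 0 < μ)
    (hu : ContinuousOn u (closedBall x r₂)) (hr₁ : 0 < r₁) (h₁₂ : r₁ < r₂)
    (h : (∀ r ∈ Ioo r₁ r₂, AnnularIdentity μ u x r₁ r₂ r) ∨
      AnnularIdentity μ u x r₁ r₂ r₁ ∨ AnnularIdentity μ u x r₁ r₂ r₂) :
    ∃ r ∈ ({r₁, r₂} : Set ℝ), ∫ s in r₁..r₂, s ^ (m - 1) * sphericalMean x s u =
      sphericalMean x r u / panProfile m μ r * ∫ s in r₁..r₂, s ^ (m - 1) * panProfile m μ s := by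
  have hint : IntegrableOn u (annulus x r₁ r₂) :=
    (hu.integrableOn_compact (isCompact_closedBall x r₂)).mono_set (annulus_subset_closedBall ..)
  rcases h with hinterior | hleft | hright
  · refine ⟨r₁, by simp, ?_⟩
    have heq : EqOn (fun _ => ∫ s in r₁..r₂, s ^ (m - 1) * sphericalMean x s u)
        (fun r => sphericalMean x r u / panProfile m μ r *
          ∫ s in r₁..r₂, s ^ (m - 1) * panProfile m μ s) (Ioo r₁ r₂) :=
      fun r hr => (hinterior r hr).integral_eq hμ hr₁ h₁₂ (hr₁.trans hr.1) hint
    exact heq.of_subset_closure continuousOn_const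
      (((continuousOn_sphericalMean_div_panProfile μ hu).mono
        (Icc_subset_Icc_left hr₁.le)).mul continuousOn_const)
      Ioo_subset_Icc_self (closure_Ioo h₁₂.ne).ge (left_mem_Icc.2 h₁₂.le)
  · exact ⟨r₁, by simp, hleft.integral_eq hμ hr₁ h₁₂ hr₁ hint⟩
  · exact ⟨r₂, by simp, hright.integral_eq hμ hr₁ h₁₂ (hr₁.trans h₁₂) hint⟩

theorem panharmonicMeanProperty_of_annularIdentity [NeZero m] (hμ : 0 < μ)
    (hu : ContinuousOn u (closedBall x R))
    (h : ∀ r₁ r₂ : ℝ, 0 < r₁ → r₁ < r₂ → r₂ ≤ R →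
      (∀ r ∈ Ioo r₁ r₂, AnnularIdentity μ u x r₁ r₂ r) ∨
        AnnularIdentity μ u x r₁ r₂ r₁ ∨ AnnularIdentity μ u x r₁ r₂ r₂) :
    PanharmonicMeanProperty μ u x R := by
  intro s ⟨hs₀, hsR⟩
  have hne (r : ℝ) : panProfile m μ r ≠ 0 := (panProfile_pos m μ r).ne'
  suffices sphericalMean x 0 u / panProfile m μ 0 = sphericalMean x s u / panProfile m μ s by
    rw [sphericalMean_zero, panProfile_zero, div_one, eq_div_iff (hne s)] at this
    rw [← this, mul_comm]
  rcases hs₀.eq_or_lt with rfl | hs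
  · rfl
  refine eq_of_forall_weighted_mean_eq (w := fun r => r ^ (m - 1) * panProfile m μ r) hs
    (continuousOn_sphericalMean_div_panProfile μ (hu.mono (closedBall_subset_closedBall hsR)))
    ((continuous_pow _).mul (continuous_panProfile m μ)).continuousOn
    (fun r hr => mul_pos (pow_pos hr.1 _) (panProfile_pos m μ r)) fun r₁ r₂ hr₁ h₁₂ hr₂ => ?_
  have hcancel (r : ℝ) : r ^ (m - 1) * panProfile m μ r *
      (sphericalMean x r u / panProfile m μ r) = r ^ (m - 1) * sphericalMean x r u := by
    rw [mul_assoc, mul_div_cancel₀ _ (hne r)]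
  simp only [hcancel]
  simpa using integral_eq_endpoint_of_annularIdentity hμ
    (hu.mono (closedBall_subset_closedBall (hr₂.trans hsR))) hr₁ h₁₂
    (h r₁ r₂ hr₁ h₁₂ (hr₂.trans hsR))

end PanharmonicMeanProperty

section Smoothness

open MeasureTheory Set Metric
open ContinuousLinearMap (lsmul)
open scoped Convolution

/-- A nonnegative radial profile that is positive precisely on `(-ρ, ρ)`; `y ↦ bumpProfile ρ ‖y‖` is
the mollifier of the smoothness argument. -/
noncomputable def bumpProfile (ρ s : ℝ) : ℝ := expNegInvGlue (ρ ^ 2 - s ^ 2)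

/-- The factor by which mollification by `y ↦ bumpProfile ρ ‖y‖` multiplies a function with the
panharmonic mean property. -/
noncomputable def bumpMass (m : ℕ) (μ ρ : ℝ) : ℝ :=
  sphereArea m * ∫ s in (0 : ℝ)..ρ, s ^ (m - 1) * (bumpProfile ρ s * panProfile m μ s)

variable {m : ℕ} {x x₀ : EuclideanSpace ℝ (Fin m)} {u v : EuclideanSpace ℝ (Fin m) → ℝ}
  {μ ρ s : ℝ}

theorem bumpProfile_eq_zero (hρ : 0 ≤ ρ) (hs : ρ ≤ s) : bumpProfile ρ s = 0 :=
  expNegInvGlue.zero_of_nonpos (sub_nonpos.2 (pow_le_pow_left₀ hρ hs 2))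

theorem bumpProfile_pos (hs₀ : 0 ≤ s) (hs : s < ρ) : 0 < bumpProfile ρ s :=
  expNegInvGlue.pos_of_pos (sub_pos.2 (pow_lt_pow_left₀ hs hs₀ two_ne_zero))

theorem contDiff_bumpProfile (ρ : ℝ) {n : ℕ∞} : ContDiff ℝ n (bumpProfile ρ) :=
  expNegInvGlue.contDiff.comp (contDiff_const.sub (contDiff_id.pow 2))

theorem contDiff_bumpProfile_norm {E : Type*} [NormedAddCommGroup E] [InnerProductSpace ℝ E]
    (ρ : ℝ) {n : ℕ∞} : ContDiff ℝ n fun y : E => bumpProfile ρ ‖y‖ :=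
  expNegInvGlue.contDiff.comp (contDiff_const.sub (contDiff_norm_sq ℝ))

theorem hasCompactSupport_bumpProfile_norm {E : Type*} [NormedAddCommGroup E] [ProperSpace E]
    (hρ : 0 ≤ ρ) : HasCompactSupport fun y : E => bumpProfile ρ ‖y‖ :=
  .intro (isCompact_closedBall 0 ρ) fun _ hy =>
    bumpProfile_eq_zero hρ (not_le.1 (mt mem_closedBall_zero_iff.2 hy)).le

theorem bumpMass_pos [NeZero m] (hρ : 0 < ρ) : 0 < bumpMass m μ ρ := by
  have hcont : Continuous fun s => s ^ (m - 1) * (bumpProfile ρ s * panProfile m μ s) :=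
    (continuous_pow _).mul ((contDiff_bumpProfile ρ (n := 0)).continuous.mul
      (continuous_panProfile m μ))
  refine mul_pos (sphereArea_pos m) (intervalIntegral.intervalIntegral_pos_of_pos_on
    (hcont.intervalIntegrable _ _) (fun s hs => ?_) hρ)
  exact mul_pos (pow_pos hs.1 _) (mul_pos (bumpProfile_pos hs.1.le hs.2) (panProfile_pos m μ s))

theorem PanharmonicMeanProperty.congr (h : PanharmonicMeanProperty μ u x ρ) (hρ : 0 ≤ ρ)
    (huv : EqOn u v (closedBall x ρ)) : PanharmonicMeanProperty μ v x ρ := fun s hs => by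
  rw [← huv (mem_closedBall_self hρ), ← h s hs]
  exact (sphericalMean_congr hs.1 (huv.mono
    (sphere_subset_closedBall.trans (closedBall_subset_closedBall hs.2)))).symm

theorem PanharmonicMeanProperty.convolution_bumpProfile_eq [NeZero m]
    (h : PanharmonicMeanProperty μ v x ρ) (hρ : 0 ≤ ρ) (hv : LocallyIntegrable v) :
    ((fun y => bumpProfile ρ ‖y‖) ⋆[lsmul ℝ ℝ] v) x = bumpMass m μ ρ * v x := by
  have hint : Integrable fun y => bumpProfile ρ ‖x - y‖ * v y :=
    ((hasCompactSupport_bumpProfile_norm hρ).convolutionExists_left (lsmul ℝ ℝ)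
      (contDiff_bumpProfile_norm ρ (n := 0)).continuous hv x).integrable_swap
  have hmean : ∀ s ∈ Ioi (0 : ℝ), s ^ (m - 1) *
      sphericalMean x s (fun y => bumpProfile ρ ‖x - y‖ * v y) =
        s ^ (m - 1) * (bumpProfile ρ s * panProfile m μ s) * v x := by
    intro s hs
    rw [sphericalMean_radial_mul (mem_Ioi.1 hs).le]
    rcases le_total s ρ with hsρ | hsρ
    · rw [h s ⟨(mem_Ioi.1 hs).le, hsρ⟩]
      ring
    · simp [bumpProfile_eq_zero hρ hsρ]
  have hsupport : ∀ s ∈ Ioi 0 \ Ioc 0 ρ,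
      s ^ (m - 1) * (bumpProfile ρ s * panProfile m μ s) = 0 := fun s hs => by
    simp [bumpProfile_eq_zero hρ (not_le.1 fun hle => hs.2 ⟨hs.1, hle⟩).le]
  calc ((fun y => bumpProfile ρ ‖y‖) ⋆[lsmul ℝ ℝ] v) x
      = ∫ y, bumpProfile ρ ‖x - y‖ * v y := convolution_lsmul_swap
    _ = bumpMass m μ ρ * v x := by
      rw [integral_eq_integral_sphericalMean x hint,
        setIntegral_congr_fun measurableSet_Ioi hmean, integral_mul_const,
        setIntegral_eq_of_subset_of_forall_sdiff_eq_zero measurableSet_Ioi Ioc_subset_Ioi_self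
          hsupport, ← intervalIntegral.integral_of_le hρ, bumpMass, mul_assoc]

theorem contDiffAt_of_panharmonicMeanProperty [NeZero m] {n : ℕ∞} (hρ : 0 < ρ)
    (hu : ContinuousOn u (closedBall x₀ (2 * ρ)))
    (h : ∀ x ∈ ball x₀ ρ, PanharmonicMeanProperty μ u x ρ) : ContDiffAt ℝ n u x₀ := by
  let v := (closedBall x₀ (2 * ρ)).indicator u
  have hv : LocallyIntegrable v :=
    ((hu.integrableOn_compact (isCompact_closedBall _ _)).integrable_indicator
      measurableSet_closedBall).locallyIntegrable
  have hsmooth : ContDiff ℝ n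
      fun x => (bumpMass m μ ρ)⁻¹ * ((fun y => bumpProfile ρ ‖y‖) ⋆[lsmul ℝ ℝ] v) x :=
    contDiff_const.mul ((hasCompactSupport_bumpProfile_norm hρ.le).contDiff_convolution_left _
      (contDiff_bumpProfile_norm ρ) hv)
  refine hsmooth.contDiffAt.congr_of_eventuallyEq ?_
  filter_upwards [ball_mem_nhds x₀ hρ] with x hx
  have hsub : closedBall x ρ ⊆ closedBall x₀ (2 * ρ) :=
    closedBall_subset_closedBall' (by linarith [mem_ball.1 hx])
  have huv : EqOn u v (closedBall x ρ) := fun y hy => (indicator_of_mem (hsub hy) u).symm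
  rw [((h x hx).congr hρ.le huv).convolution_bumpProfile_eq hρ.le hv,
    inv_mul_cancel_left₀ (bumpMass_pos hρ).ne', huv (mem_closedBall_self hρ.le)]

end Smoothness

section SphereMoments

open MeasureTheory Set Metric Module
open scoped Pointwise RealInnerProductSpace

variable {E : Type*} [NormedAddCommGroup E] [InnerProductSpace ℝ E] [FiniteDimensional ℝ E]
  [MeasurableSpace E] [BorelSpace E]

theorem integral_toSphere_comp_linearIsometryEquiv {F : Type*} [NormedAddCommGroup F]
    [NormedSpace ℝ F] (T : E ≃ₗᵢ[ℝ] E) (f : E → F) :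
    ∫ y : sphere (0 : E) 1, f (T y) ∂volume.toSphere =
      ∫ y : sphere (0 : E) 1, f y ∂volume.toSphere := by
  let φ : sphere (0 : E) 1 ≃ₜ sphere (0 : E) 1 := T.toHomeomorph.subtype fun y => by simp
  have hφ : MeasurePreserving φ volume.toSphere volume.toSphere := by
    refine ⟨φ.measurable, Measure.ext fun t ht => ?_⟩
    have hcone : Ioo (0 : ℝ) 1 • (Subtype.val '' (φ ⁻¹' t)) =
        T ⁻¹' (Ioo (0 : ℝ) 1 • (Subtype.val '' t)) := by
      ext y
      constructor
      · rintro ⟨r, hr, _, ⟨z, hz, rfl⟩, rfl⟩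
        exact ⟨r, hr, φ z, ⟨φ z, hz, rfl⟩, (T.map_smul r z).symm⟩
      · rintro ⟨r, hr, _, ⟨z, hz, rfl⟩, hy⟩
        refine ⟨r, hr, φ.symm z, ⟨φ.symm z, by simpa using hz, rfl⟩, T.injective ?_⟩
        rw [← hy, T.map_smul]
        exact congrArg (r • ·) (T.apply_symm_apply z)
    rw [Measure.map_apply φ.measurable ht, Measure.toSphere_apply' _ (φ.measurable ht),
      Measure.toSphere_apply' _ ht, hcone,
      T.measurePreserving.measure_preimage_emb T.toHomeomorph.measurableEmbedding]
  exact hφ.integral_comp φ.measurableEmbedding fun y => f y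

theorem integral_toSphere_clm (L : E →L[ℝ] ℝ) :
    ∫ y : sphere (0 : E) 1, L y ∂volume.toSphere = 0 := by
  have h := integral_toSphere_comp_linearIsometryEquiv (LinearIsometryEquiv.neg ℝ) L
  simp only [LinearIsometryEquiv.coe_neg, map_neg, integral_neg] at h
  linarith

theorem integral_toSphere_inner_mul_inner_of_orthogonal {v w : E} (h : ⟪v, w⟫ = 0) :
    ∫ y : sphere (0 : E) 1, ⟪v, y⟫ * ⟪w, y⟫ ∂volume.toSphere = 0 := by
  let T := (ℝ ∙ v)ᗮ.reflection
  have hv (y : E) : ⟪v, T y⟫ = -⟪v, y⟫ := by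
    rw [← T.inner_map_map, Submodule.reflection_reflection,
      Submodule.reflection_orthogonalComplement_singleton_eq_neg, inner_neg_left]
  have hw (y : E) : ⟪w, T y⟫ = ⟪w, y⟫ := by
    rw [← T.inner_map_map, Submodule.reflection_reflection,
      Submodule.reflection_mem_subspace_eq_self
        (Submodule.mem_orthogonal_singleton_iff_inner_right.2 h)]
  have hT := integral_toSphere_comp_linearIsometryEquiv T fun y => ⟪v, y⟫ * ⟪w, y⟫
  simp only [hv, hw, neg_mul, integral_neg] at hT
  linarith

theorem integral_toSphere_inner_sq_eq_of_norm_eq {v w : E} (h : ‖v‖ = ‖w‖) :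
    ∫ y : sphere (0 : E) 1, ⟪v, y⟫ ^ 2 ∂volume.toSphere =
      ∫ y : sphere (0 : E) 1, ⟪w, y⟫ ^ 2 ∂volume.toSphere := by
  let T := (ℝ ∙ (v - w))ᗮ.reflection
  have hT (y : E) : ⟪w, T y⟫ = ⟪v, y⟫ := by
    rw [← Submodule.reflection_sub h, T.inner_map_map]
  rw [← integral_toSphere_comp_linearIsometryEquiv T fun y => ⟪w, y⟫ ^ 2]
  simp only [hT]

theorem integrable_toSphere_of_continuous {f : sphere (0 : E) 1 → ℝ} (hf : Continuous f) :
    Integrable f volume.toSphere :=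
  hf.integrable_of_hasCompactSupport (.of_compactSpace f)

variable {ι : Type*} [Fintype ι]

theorem finrank_mul_integral_toSphere_inner_sq (b : OrthonormalBasis ι ℝ E) (i : ι) :
    finrank ℝ E * ∫ y : sphere (0 : E) 1, ⟪b i, y⟫ ^ 2 ∂volume.toSphere =
      (volume : Measure E).toSphere.real univ := by
  calc finrank ℝ E * ∫ y : sphere (0 : E) 1, ⟪b i, y⟫ ^ 2 ∂volume.toSphere
      = ∑ j, ∫ y : sphere (0 : E) 1, ⟪b j, y⟫ ^ 2 ∂volume.toSphere := by
        rw [Finset.sum_congr rfl fun j _ => integral_toSphere_inner_sq_eq_of_norm_eq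
          (show ‖b j‖ = ‖b i‖ by simp), Finset.sum_const, Finset.card_univ, nsmul_eq_mul,
          finrank_eq_card_basis b.toBasis]
    _ = ∫ y : sphere (0 : E) 1, ∑ j, ⟪b j, y⟫ ^ 2 ∂volume.toSphere :=
        (integral_finsetSum _ fun j _ => integrable_toSphere_of_continuous (by fun_prop)).symm
    _ = _ := by simp [b.sum_sq_inner_right]

theorem finrank_mul_integral_toSphere_bilin (b : OrthonormalBasis ι ℝ E)
    (B : E →L[ℝ] E →L[ℝ] ℝ) :
    finrank ℝ E * ∫ y : sphere (0 : E) 1, B y y ∂volume.toSphere =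
      (volume : Measure E).toSphere.real univ * ∑ i, B (b i) (b i) := by
  classical
  have hexpand (y : sphere (0 : E) 1) : B y y =
      ∑ i, ∑ j, ⟪b i, y⟫ * ⟪b j, y⟫ * B (b i) (b j) := by
    conv_lhs => rw [← b.sum_repr' (y : E)]
    simp only [map_sum, map_smul, _root_.sum_apply, _root_.smul_apply, smul_eq_mul, Finset.mul_sum]
    rw [Finset.sum_comm]
    simp only [mul_left_comm, mul_assoc]
  have hmoment (i j : ι) : finrank ℝ E *
      ∫ y : sphere (0 : E) 1, ⟪b i, y⟫ * ⟪b j, y⟫ * B (b i) (b j) ∂volume.toSphere =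
        if i = j then (volume : Measure E).toSphere.real univ * B (b i) (b i) else 0 := by
    rw [integral_mul_const, ← mul_assoc]
    split_ifs with hij
    · subst hij
      simp only [← sq, finrank_mul_integral_toSphere_inner_sq]
    · rw [integral_toSphere_inner_mul_inner_of_orthogonal (b.inner_eq_zero hij), mul_zero, zero_mul]
  calc finrank ℝ E * ∫ y : sphere (0 : E) 1, B y y ∂volume.toSphere
      = ∑ i, ∑ j, finrank ℝ E *
          ∫ y : sphere (0 : E) 1, ⟪b i, y⟫ * ⟪b j, y⟫ * B (b i) (b j) ∂volume.toSphere := by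
        simp only [hexpand]
        rw [integral_finsetSum _ fun i _ => integrable_toSphere_of_continuous (by fun_prop),
          Finset.mul_sum]
        refine Finset.sum_congr rfl fun i _ => ?_
        rw [integral_finsetSum _ fun j _ => integrable_toSphere_of_continuous (by fun_prop),
          Finset.mul_sum]
    _ = _ := by simp only [hmoment, Finset.sum_ite_eq, Finset.mem_univ, if_true, Finset.mul_sum]

end SphereMoments

section SecondOrderExpansions

open MeasureTheory Set Metric Module Filter Asymptotics
open scoped Topology

theorem isLittleO_taylor_two {E : Type*} [NormedAddCommGroup E] [NormedSpace ℝ E] {u : E → ℝ}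
    {x : E} (hu : ContDiffAt ℝ 2 u x) :
    (fun z => u z - u x - fderiv ℝ u x (z - x) - 1 / 2 * fderiv ℝ (fderiv ℝ u) x (z - x) (z - x))
      =o[𝓝 x] fun z => ‖z - x‖ ^ 2 := by
  set B := fderiv ℝ (fderiv ℝ u) x
  have hsymm (v w : E) : B v w = B w v := hu.isSymmSndFDerivAt (by simp) v w
  have hfderiv : (fun z => fderiv ℝ u z - fderiv ℝ u x - B (z - x)) =o[𝓝 x] fun z => z - x :=
    ((hu.fderiv_right (m := 1) le_rfl).differentiableAt one_ne_zero).hasFDerivAt.isLittleO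
  obtain ⟨δ, hδ, hdiff⟩ := eventually_nhds_iff_ball.1 (hu.eventually (by simp))
  have hderiv : ∀ z ∈ ball x δ, HasFDerivWithinAt
      (fun z => u z - u x - fderiv ℝ u x (z - x) - 1 / 2 * B (z - x) (z - x))
      (fderiv ℝ u z - fderiv ℝ u x - B (z - x)) (ball x δ) z := by
    intro z hz
    have hsub : HasFDerivAt (fun z => z - x) (.id ℝ E) z := (hasFDerivAt_id z).sub_const x
    have hquad : HasFDerivAt (fun z => B (z - x) (z - x)) _ z :=
      (B.hasFDerivAt.comp z hsub).clm_apply hsub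
    refine (((((hdiff z hz).differentiableAt two_ne_zero).hasFDerivAt.sub_const (u x)).sub
      ((fderiv ℝ u x).hasFDerivAt.comp z hsub)).sub (hquad.const_mul (1 / 2))).congr_fderiv ?_
      |>.hasFDerivWithinAt
    ext w
    simp only [ContinuousLinearMap.comp_id, one_div, Function.comp_apply, map_sub, smul_add,
      _root_.sub_apply, _root_.add_apply, _root_.smul_apply, smul_eq_mul,
      ContinuousLinearMap.flip_apply, hsymm w, sub_right_inj]
    ring
  have hx : 𝓝[ball x δ] x = 𝓝 x := isOpen_ball.nhdsWithin_eq (mem_ball_self hδ)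
  simpa [hx] using (convex_ball x δ).isLittleO_pow_succ (n := 1) (mem_ball_self hδ) hderiv
    (by simpa [hx] using hfderiv.norm_right)

variable {m : ℕ} {x : EuclideanSpace ℝ (Fin m)} {u g : EuclideanSpace ℝ (Fin m) → ℝ} {μ s : ℝ}

theorem sphericalMean_sub (hs : 0 ≤ s) (hu : ContinuousOn u (sphere x s))
    (hg : ContinuousOn g (sphere x s)) :
    sphericalMean x s (fun y => u y - g y) = sphericalMean x s u - sphericalMean x s g := by
  simp only [sphericalMean]
  rw [integral_sub, mul_sub]
  · exact integrable_toSphere_of_continuous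
      (hu.comp_continuous (by fun_prop) (add_smul_mem_sphere hs))
  · exact integrable_toSphere_of_continuous
      (hg.comp_continuous (by fun_prop) (add_smul_mem_sphere hs))

theorem isLittleO_sphericalMean [NeZero m] {n : ℕ} (hg : g =o[𝓝 x] fun z => ‖z - x‖ ^ n) :
    (fun s => sphericalMean x s g) =o[𝓝[>] 0] fun s => s ^ n := by
  refine isLittleO_iff.2 fun ε hε => ?_
  obtain ⟨δ, hδ, hball⟩ := eventually_nhds_iff_ball.1 (hg.def hε)
  filter_upwards [Ioo_mem_nhdsGT hδ] with s ⟨hs₀, hsδ⟩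
  have hbound (y : sphere (0 : EuclideanSpace ℝ (Fin m)) 1) :
      ‖g (x + s • (y : EuclideanSpace ℝ (Fin m)))‖ ≤ ε * s ^ n := by
    have hy : x + s • (y : EuclideanSpace ℝ (Fin m)) ∈ sphere x s := add_smul_mem_sphere hs₀.le y
    refine (hball _ (sphere_subset_closedBall.trans (closedBall_subset_ball hsδ) hy)).trans_eq ?_
    rw [mem_sphere_iff_norm.1 hy, norm_pow, Real.norm_of_nonneg hs₀.le]
  have hmean := norm_integral_le_of_norm_le_const (μ := volume.toSphere) (.of_forall hbound)
  have harea := sphereArea_pos m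
  rw [sphericalMean, norm_mul, ← sphereArea, norm_inv, Real.norm_of_nonneg harea.le,
    inv_mul_le_iff₀ harea, norm_pow, Real.norm_of_nonneg hs₀.le, mul_comm]
  exact hmean

theorem sphericalMean_clm (L : EuclideanSpace ℝ (Fin m) →L[ℝ] ℝ) (s : ℝ) :
    sphericalMean x s (fun z => L (z - x)) = 0 := by
  simp only [sphericalMean, add_sub_cancel_left, map_smul, integral_smul, integral_toSphere_clm,
    smul_zero, mul_zero]

theorem laplacian_eq_sum_fderiv_fderiv (u : EuclideanSpace ℝ (Fin m) → ℝ)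
    (x : EuclideanSpace ℝ (Fin m)) : Laplacian.laplacian u x =
      ∑ i, fderiv ℝ (fderiv ℝ u) x (EuclideanSpace.basisFun (Fin m) ℝ i)
        (EuclideanSpace.basisFun (Fin m) ℝ i) := by
  rw [InnerProductSpace.laplacian_eq_iteratedFDeriv_orthonormalBasis u
    (EuclideanSpace.basisFun (Fin m) ℝ)]
  simp [iteratedFDeriv_two_apply]

theorem sphericalMean_fderiv_fderiv [NeZero m] (u : EuclideanSpace ℝ (Fin m) → ℝ)
    (x : EuclideanSpace ℝ (Fin m)) (s : ℝ) :
    sphericalMean x s (fun z => fderiv ℝ (fderiv ℝ u) x (z - x) (z - x)) =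
      Laplacian.laplacian u x / m * s ^ 2 := by
  have hm : (m : ℝ) ≠ 0 := NeZero.ne _
  have hbilin := finrank_mul_integral_toSphere_bilin (EuclideanSpace.basisFun (Fin m) ℝ)
    (fderiv ℝ (fderiv ℝ u) x)
  rw [finrank_euclideanSpace_fin, ← laplacian_eq_sum_fderiv_fderiv] at hbilin
  have harea : (volume : Measure (EuclideanSpace ℝ (Fin m))).toSphere.real univ ≠ 0 :=
    (sphereArea_pos m).ne'
  simp only [sphericalMean, add_sub_cancel_left, map_smul, _root_.smul_apply, smul_eq_mul,
    integral_const_mul]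
  field_simp
  linear_combination s ^ 2 * hbilin

theorem isLittleO_sphericalMean_sub [NeZero m] (hu : ContDiffAt ℝ 2 u x) :
    (fun s => sphericalMean x s u - u x - Laplacian.laplacian u x / (2 * m) * s ^ 2)
      =o[𝓝[>] 0] fun s => s ^ 2 := by
  refine (isLittleO_sphericalMean (isLittleO_taylor_two hu)).congr' ?_ .rfl
  obtain ⟨R, hR, hdiff⟩ := nhds_basis_closedBall.eventually_iff.1 (hu.eventually (by simp))
  filter_upwards [Ioo_mem_nhdsGT hR] with s ⟨hs₀, hsR⟩
  have hcont : ContinuousOn u (sphere x s) := fun z hz => (hdiff (sphere_subset_closedBall.trans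
    (closedBall_subset_closedBall hsR.le) hz)).continuousAt.continuousWithinAt
  rw [sphericalMean_sub hs₀.le (by fun_prop) (by fun_prop),
    sphericalMean_sub hs₀.le (by fun_prop) (by fun_prop),
    sphericalMean_sub hs₀.le hcont (by fun_prop), sphericalMean_const, sphericalMean_clm,
    sphericalMean_const_mul, sphericalMean_fderiv_fderiv]
  ring

theorem isLittleO_panProfile_sub (m : ℕ) [NeZero m] (μ : ℝ) :
    (fun s => panProfile m μ s - 1 - μ ^ 2 / (2 * m) * s ^ 2) =o[𝓝 0] fun s => s ^ 2 := by
  have htendsto : Tendsto (fun s : ℝ => μ ^ 2 / 4 * s ^ 2) (𝓝 0) (𝓝 0) :=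
    Continuous.tendsto' (by fun_prop) _ _ (by simp)
  have hderiv := (hasDerivAt_hypLimit_zero (half_natCast_pos m)).isLittleO.comp_tendsto htendsto
  have hbound : ((fun z => z - 0) ∘ fun s => μ ^ 2 / 4 * s ^ 2) =O[𝓝 0] fun s => s ^ 2 := by
    simpa [Function.comp_def] using isBigO_const_mul_self (μ ^ 2 / 4) (fun s : ℝ => s ^ 2) (𝓝 0)
  refine (hderiv.trans_isBigO hbound).congr_left fun s => ?_
  have hm : (m : ℝ) ≠ 0 := NeZero.ne _
  simp only [Function.comp_apply, panProfile, hypLimit_zero (half_natCast_pos m), sub_zero,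
    smul_eq_mul]
  field_simp
  ring

theorem PanharmonicMeanProperty.laplacian_eq [NeZero m] {R : ℝ}
    (h : PanharmonicMeanProperty μ u x R) (hR : 0 < R) (hu : ContDiffAt ℝ 2 u x) :
    Laplacian.laplacian u x = μ ^ 2 * u x := by
  have hm : (m : ℝ) ≠ 0 := NeZero.ne _
  by_contra hne
  have hcoeff : (μ ^ 2 * u x - Laplacian.laplacian u x) / (2 * m) ≠ 0 :=
    div_ne_zero (sub_ne_zero.2 (Ne.symm hne)) (mul_ne_zero two_ne_zero hm)
  have hdiff : (fun s : ℝ => (μ ^ 2 * u x - Laplacian.laplacian u x) / (2 * m) * s ^ 2)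
      =o[𝓝[>] 0] fun s => s ^ 2 := by
    refine ((isLittleO_sphericalMean_sub hu).sub (((isLittleO_panProfile_sub m μ).mono
      nhdsWithin_le_nhds).const_mul_left (u x))).congr' ?_ .rfl
    filter_upwards [Ioo_mem_nhdsGT hR] with s hs
    rw [h s (Ioo_subset_Icc_self hs)]
    field_simp
    ring
  refine isLittleO_irrefl ?_ ((isLittleO_const_mul_left_iff hcoeff).1 hdiff)
  have hpos : ∀ᶠ s in 𝓝[>] (0 : ℝ), 0 < s := self_mem_nhdsWithin
  exact hpos.frequently.mono fun s hs => pow_ne_zero 2 hs.ne'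

end SecondOrderExpansions

section MainTheorem

open Set Metric

theorem theorem4p3_general {m : ℕ} [NeZero m] {D : Set (EuclideanSpace ℝ (Fin m))} (hD : IsOpen D)
    {μ : ℝ} (hμ : 0 < μ) {u : EuclideanSpace ℝ (Fin m) → ℝ} (hu : ContinuousOn u D)
    (h : ∀ x ∈ D, ∀ r₁ r₂ : ℝ, 0 < r₁ → r₁ < r₂ → AdmissibleBall D x r₂ →
      (∀ r ∈ Ioo r₁ r₂, AnnularIdentity μ u x r₁ r₂ r) ∨
        AnnularIdentity μ u x r₁ r₂ r₁ ∨ AnnularIdentity μ u x r₁ r₂ r₂) :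
    PanharmonicOn μ u D := by
  have hmean {x : EuclideanSpace ℝ (Fin m)} {R : ℝ} (hR : 0 < R) (hsub : closedBall x R ⊆ D) :
      PanharmonicMeanProperty μ u x R :=
    panharmonicMeanProperty_of_annularIdentity hμ (hu.mono hsub) fun r₁ r₂ hr₁ h₁₂ hr₂ =>
      h x (hsub (mem_closedBall_self hR.le)) r₁ r₂ hr₁ h₁₂ <| closure_ball_subset_closedBall.trans
        ((closedBall_subset_closedBall hr₂).trans hsub)
  have hsolves (x : EuclideanSpace ℝ (Fin m)) (hx : x ∈ D) :
      ContDiffAt ℝ 2 u x ∧ Laplacian.laplacian u x = μ ^ 2 * u x := by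
    obtain ⟨R, hR, hsub⟩ := nhds_basis_closedBall.mem_iff.1 (hD.mem_nhds hx)
    have hsmooth : ContDiffAt ℝ 2 u x :=
      contDiffAt_of_panharmonicMeanProperty (half_pos hR)
        (hu.mono (by rwa [mul_div_cancel₀ R two_ne_zero])) fun y hy => hmean (half_pos hR) <|
          (closedBall_subset_closedBall' (by linarith [mem_ball.1 hy])).trans hsub
    exact ⟨hsmooth, (hmean hR hsub).laplacian_eq hR hsmooth⟩
  exact ⟨fun x hx => (hsolves x hx).1.contDiffWithinAt, fun x hx => sub_eq_zero.2 (hsolves x hx).2⟩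

end MainTheorem

theorem theorem4p3 {m : ℕ} (hm : 2 ≤ m) (D : Set (EuclideanSpace ℝ (Fin m)))
    (hD_open : IsOpen D) (hD_conn : IsConnected D) (hD_bdd : Bornology.IsBounded D)
    (μ : ℝ) (hμ : 0 < μ) (u : EuclideanSpace ℝ (Fin m) → ℝ) (hu : ContinuousOn u D)
    (h : ∀ x ∈ D, ∀ r₁ r₂ : ℝ, 0 < r₁ → r₁ < r₂ → AdmissibleBall D x r₂ →
      (∀ r ∈ Set.Ioo r₁ r₂, AnnularIdentity μ u x r₁ r₂ r) ∨
        AnnularIdentity μ u x r₁ r₂ r₁ ∨ AnnularIdentity μ u x r₁ r₂ r₂) :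
    PanharmonicOn μ u D := by
  have : NeZero m := ⟨by lia⟩
  exact theorem4p3_general hD_open hμ hu h
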